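/- Let $E$ be a finite-dimensional real normed space with dual unit ball $B^*=\{\varphi\in E^*:\|\varphi\|^*\le 1\}$. For non-zero $x\in E$ let $\partial x=\{\varphi\in E^*:\|\varphi\|^*=1,\ \varphi(x)=\|x\|\}$ be its set of norming functionals. The reduced Minkowski sum of $C,D\subseteq B^*$ is $C\boxplus D=(C+D)\cap B^*$. A parenthesization $\langle\Sigma\rangle$ of a finite non-empty family $\Sigma=\{A_i:i\in I\}$ of subsets of $B^*$ is a bracketing, in the usual sense, of $A_{j(1)}\boxplus\dots\boxplus A_{j(|I|)}$ for some ordering $j(1),\dots,j(|I|)$ of $I$; it is identified with the set it evaluates to. A Steiner tree of a finite set $N\subset E$ is a finite tree whose vertices are points of $E$ and whose vertex set contains $N$; its length is the sum of $\|x-y\|$ over its edges $xy$; a Steiner minimal tree (SMT) of $N$ is a Steiner tree of $N$ of minimum length. **Theorem (Steiner points).** Let $k\ge 1$, let $p_0,p_1,\dots,p_k\in E$ be distinct, and let $N=\{p_1,\dots,p_k\}$. 1. The star joining $p_0$ to each $p_i$, $1\le i\le k$, is an SMT of $N$ if and only if $o\in\langle\Sigma\rangle$ for every parenthesization $\langle\Sigma\rangle$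 of $\Sigma=\{\partial(p_i-p_0):1\le i\le k\}$. 2. If $k\ge 2$, this star is an SMT of $N$ if and only if $o\in\langle\Sigma'\rangle+\partial(p_k-p_0)$ for every parenthesization $\langle\Sigma'\rangle$ of $\Sigma'=\{\partial(p_i-p_0):1\le i\le k-1\}$. 3. If the norm is differentiable at every non-zero point, then each $p_i-p_0$ has exactly one norming functional $\varphi_i$ ($1\le i\le k$), and the star is an SMT of $N$ if and only if $\sum_{i=1}^k\varphi_i=o$ and $\bigl\|\sum_{i\in I}\varphi_i\bigr\|^*\le 1$ for every $I\subseteq\{1,\dots,k\}$. -/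

import Mathlib

open scoped Pointwise

namespace LocalSteiner

noncomputable section

variable {E : Type*} [NormedAddCommGroup E] [NormedSpace ℝ E]

/-! ### Steiner minimal trees -/

/-- A finite simple graph whose vertices are points of `E`. -/
structure PointGraph (E : Type*) where
  /-- the vertex set -/
  verts : Finset E
  /-- the edges -/
  graph : SimpleGraph verts

/-- The distance in the norm between the two endpoints of an edge. -/
def edgeLength (V : Finset E) : Sym2 V → ℝ :=
  Sym2.lift ⟨fun x y => ‖(x : E) - (y : E)‖, fun x y => norm_sub_rev (x : E) (y : E)⟩

open Classical in
/-- The length of a finite graph on points of `E`: the sum of the lengths of its edges. -/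
def PointGraph.length (T : PointGraph E) : ℝ :=
  ∑ e ∈ T.graph.edgeFinset, edgeLength T.verts e

/-- `T` is a Steiner tree of `N`: a tree whose vertex set contains `N`. -/
def IsSteinerTree {E : Type*} (N : Finset E) (T : PointGraph E) : Prop :=
  N ⊆ T.verts ∧ T.graph.IsTree

/-- `T` is a Steiner minimal tree (SMT) of `N`: a shortest Steiner tree of `N`. -/
def IsSMT (N : Finset E) (T : PointGraph E) : Prop :=
  IsSteinerTree N T ∧ ∀ T' : PointGraph E, IsSteinerTree N T' → T.length ≤ T'.length

open Classical in
/-- The star joining the centre `c` to each other point of `N`. -/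
def starAt {E : Type*} (c : E) (N : Finset E) : PointGraph E where
  verts := insert c N
  graph := SimpleGraph.starGraph ⟨c, Finset.mem_insert_self c N⟩

/-! ### Norming functionals and reduced Minkowski sums -/

/-- The set `∂x` of norming functionals of (a non-zero) `x`. -/
def norming (x : E) : Set (StrongDual ℝ E) :=
  {φ | ‖φ‖ = 1 ∧ φ x = ‖x‖}

/-- The reduced Minkowski sum `C ⊞ D`: the Minkowski sum intersected with the dual unit ball. -/
def reducedSum (C D : Set (StrongDual ℝ E)) : Set (StrongDual ℝ E) :=
  {χ | ∃ φ ∈ C, ∃ ψ ∈ D, χ = φ + ψ ∧ ‖χ‖ ≤ 1}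

/-- The parenthesizations of a finite non-empty family with support (index set) `I`: every index
in `I` is used exactly once, in any order and with any bracketing. -/
inductive Parenthesization {ι : Type*} [DecidableEq ι] : Finset ι → Type _
  | single (i : ι) : Parenthesization {i}
  | sum {I J : Finset ι} (h : Disjoint I J) (P : Parenthesization I) (Q : Parenthesization J) :
      Parenthesization (I ∪ J)

/-- The set to which a parenthesization of the family `A` evaluates under `⊞`. -/
def Parenthesization.eval {ι : Type*} [DecidableEq ι] (A : ι → Set (StrongDual ℝ E)) :
    {I : Finset ι} → Parenthesization I → Set (StrongDual ℝ E)
  | _, .single i => A i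
  | _, .sum _ P Q => reducedSum (P.eval A) (Q.eval A)

end

end LocalSteiner

/-! Write `o` for the centre. For a parenthesization `P`, let f_P(x) be the least length of a
network that branches like `P` and joins the terminals to `x`. It is convex and 1-Lipschitz, and
`Joins` describes its epigraph. The value of `P` is exactly the set of φ for which (length of the
star) - φ(x - o) ≤ f_P(x) for all x. One inclusion is calibration (`Joins.le_of_mem_eval`): add the
inequalities χ(z) ≤ ‖z‖ over the edges. The other (`mem_eval_of_forall_le`) is by induction, with
Hahn-Banach splitting φ at each branching into functionals for the two subnetworks.

If the star is an SMT, every network is at least as long, so 0 calibrates every f_P. Conversely,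
rooting a Steiner tree at the last terminal exhibits it as a network for some `P` on the others; 0 =
φ + ψ with φ in the value of `P` and ψ norming the last edge bounds its length below by that of the
star. When the norm is differentiable all sets are singletons, and every subset sum occurs inside
some parenthesization. -/

namespace LocalSteiner

/-! ### Values of parenthesizations as calibrating functionals -/

section Calibration

variable {E : Type*} [NormedAddCommGroup E] {ι : Type*} [DecidableEq ι]

/-- `P.Joins q x c`: the terminals `q i` can be joined to the root `x` by a network branching
according to `P`, whose length is at most `c`. -/
def Parenthesization.Joins (q : ι → E) : {I : Finset ι} → Parenthesization I → E → ℝ → Prop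
  | _, .single i, x, c => ‖q i - x‖ ≤ c
  | _, .sum _ P Q, x, c =>
      ∃ y c₁ c₂, P.Joins q y c₁ ∧ Q.Joins q y c₂ ∧ ‖y - x‖ + c₁ + c₂ ≤ c

namespace Parenthesization

variable {q : ι → E} {I : Finset ι}

/-- Only the last edge, the one into the root, changes. This is the 1-Lipschitz property together
with upward closure in the cost. -/
theorem Joins.move {P : Parenthesization I} {x y : E} {c d : ℝ} (h : P.Joins q x c)
    (hd : ‖x - y‖ + c ≤ d) : P.Joins q y d := by
  cases P with
  | single i =>
    have := norm_sub_le_norm_sub_add_norm_sub (q i) x y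
    simp only [Joins] at h ⊢
    linarith
  | sum hIJ P Q =>
    obtain ⟨z, c₁, c₂, h₁, h₂, hc⟩ := h
    have := norm_sub_le_norm_sub_add_norm_sub z x y
    exact ⟨z, c₁, c₂, h₁, h₂, by linarith⟩

/-- Collapse all branch points to `o`: the star is a degenerate network for every `P`. -/
theorem joins_star (P : Parenthesization I) (o : E) :
    P.Joins q o (∑ i ∈ I, ‖q i - o‖) := by
  induction P with
  | single i => simp [Joins]
  | sum hIJ P Q hP hQ =>
    refine ⟨o, _, _, hP, hQ, ?_⟩
    rw [Finset.sum_union hIJ]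
    simp

variable [NormedSpace ℝ E]

/-- Two networks with the same branching can be averaged branch point by branch point, and each edge
length is convex in its endpoints. -/
theorem convex_joins (P : Parenthesization I) :
    Convex ℝ {z : E × ℝ | P.Joins q z.1 z.2} := by
  have key : ∀ {u v x y : E} {a b : ℝ}, 0 ≤ a → 0 ≤ b →
      ‖(a • u + b • v) - (a • x + b • y)‖ ≤ a * ‖u - x‖ + b * ‖v - y‖ := by
    intro u v x y a b ha hb
    calc ‖(a • u + b • v) - (a • x + b • y)‖ = ‖a • (u - x) + b • (v - y)‖ := by
          congr 1; module
      _ ≤ ‖a • (u - x)‖ + ‖b • (v - y)‖ := norm_add_le _ _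
      _ = _ := by simp [norm_smul, abs_of_nonneg ha, abs_of_nonneg hb]
  induction P with
  | single i =>
    rintro ⟨x, c⟩ hx ⟨y, d⟩ hy a b ha hb hab
    simp only [Set.mem_ofPred_eq, Joins, Prod.fst_add, Prod.snd_add, Prod.smul_fst,
      Prod.smul_snd, smul_eq_mul] at hx hy ⊢
    have h := key (u := q i) (v := q i) (x := x) (y := y) ha hb
    rw [← add_smul, hab, one_smul] at h
    exact h.trans (by gcongr)
  | sum hIJ P Q hP hQ =>
    rintro ⟨x, c⟩ ⟨u, c₁, c₂, h₁, h₂, hc⟩ ⟨y, d⟩ ⟨v, d₁, d₂, k₁, k₂, hd⟩ a b ha hb hab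
    refine ⟨a • u + b • v, a * c₁ + b * d₁, a * c₂ + b * d₂,
      @hP (u, c₁) h₁ (v, d₁) k₁ a b ha hb hab, @hQ (u, c₂) h₂ (v, d₂) k₂ a b ha hb hab, ?_⟩
    simp only [Prod.fst_add, Prod.snd_add, Prod.smul_fst, Prod.smul_snd, smul_eq_mul] at hc hd ⊢
    have h := key (u := u) (v := v) (x := x) (y := y) ha hb
    have h₃ := mul_le_mul_of_nonneg_left hc ha
    have h₄ := mul_le_mul_of_nonneg_left hd hb
    linarith

/-- A functional in the value of `P` calibrates every network branching according to `P`. -/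
theorem Joins.le_of_mem_eval {P : Parenthesization I} {o x : E} {c : ℝ}
    {φ : StrongDual ℝ E} (h : P.Joins q x c) (hφ : φ ∈ P.eval (fun i => norming (q i - o))) :
    ∑ i ∈ I, ‖q i - o‖ - φ (x - o) ≤ c := by
  have hle : ∀ {χ : StrongDual ℝ E} (z : E), ‖χ‖ ≤ 1 → χ z ≤ ‖z‖ := fun {χ} z hχ =>
    (le_abs_self _).trans ((χ.le_opNorm z).trans (mul_le_of_le_one_left (norm_nonneg z) hχ))
  induction P generalizing x c φ with
  | single i =>
    obtain ⟨h₁, h₂⟩ := hφ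
    have h₃ := hle (q i - x) h₁.le
    simp only [Joins] at h
    have h₄ : φ (q i - x) = φ (q i - o) - φ (x - o) := by simp
    simp only [Finset.sum_singleton]
    linarith
  | sum hIJ P Q hP hQ =>
    obtain ⟨y, c₁, c₂, h₁, h₂, hc⟩ := h
    obtain ⟨φ₁, hφ₁, φ₂, hφ₂, rfl, hn⟩ := hφ
    have h₃ := hP h₁ hφ₁
    have h₄ := hQ h₂ hφ₂
    have h₅ := hle (y - x) hn
    rw [Finset.sum_union hIJ]
    simp only [add_apply, map_sub] at *
    linarith

end Parenthesization

variable [NormedSpace ℝ E]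

/-- A sandwich theorem for the infimal sum of two convex 1-Lipschitz functions, given by their
epigraphs. -/
theorem exists_add_eq_of_forall_le {A B : Set (E × ℝ)} (hA : Convex ℝ A) (hB : Convex ℝ B)
    (hmove : ∀ x c y d, (x, c) ∈ A → ‖x - y‖ + c ≤ d → (y, d) ∈ A) {o : E} {a b : ℝ}
    (ha : (o, a) ∈ A) (hb : (o, b) ∈ B) {χ : StrongDual ℝ E}
    (h : ∀ y c₁ c₂, (y, c₁) ∈ A → (y, c₂) ∈ B → a + b - χ (y - o) ≤ c₁ + c₂) :
    ∃ φ ψ : StrongDual ℝ E, χ = φ + ψ ∧ (∀ x c, (x, c) ∈ A → a - φ (x - o) ≤ c) ∧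
      ∀ x c, (x, c) ∈ B → b - ψ (x - o) ≤ c := by
  -- If `A` and `B` are the epigraphs of f and g, then `s` is the strict epigraph of f and `t` the
  -- hypograph of the affine bound minus g. A hyperplane between them is the graph of the required
  -- affine function.
  let s : Set (E × ℝ) := {z | ∃ c < z.2, (z.1, c) ∈ A}
  let t : Set (E × ℝ) := {z | (z.1, a + b - χ (z.1 - o) - z.2) ∈ B}
  have hs : IsOpen s := by
    have : s = ⋃ w ∈ A, {z : E × ℝ | ‖w.1 - z.1‖ + w.2 < z.2} := by
      ext ⟨x, r⟩
      simp only [s, Set.mem_ofPred_eq, Set.mem_iUnion, exists_prop]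
      constructor
      · rintro ⟨c, hc, hx⟩
        exact ⟨(x, c), hx, by simpa using hc⟩
      · rintro ⟨⟨y, c⟩, hy, hc⟩
        exact ⟨_, hc, hmove _ _ _ _ hy le_rfl⟩
    rw [this]
    exact isOpen_biUnion fun w _ => isOpen_lt (by fun_prop) (by fun_prop)
  have hsc : Convex ℝ s := by
    rintro ⟨x, r⟩ ⟨c, hc, hx⟩ ⟨y, r'⟩ ⟨d, hd, hy⟩ α β hα hβ hαβ
    refine ⟨α * c + β * d, ?_, hA hx hy hα hβ hαβ⟩
    simp only [Prod.snd_add, Prod.smul_snd, smul_eq_mul] at hc hd ⊢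
    rcases hα.eq_or_lt with rfl | hα'
    · have : β = 1 := by linarith
      subst this
      linarith
    · have h₁ := mul_lt_mul_of_pos_left hc hα'
      have h₂ := mul_le_mul_of_nonneg_left hd.le hβ
      linarith
  have htc : Convex ℝ t := by
    rintro ⟨x, r⟩ hx ⟨y, r'⟩ hy α β hα hβ hαβ
    have := hB hx hy hα hβ hαβ
    simp only [t, Set.mem_ofPred_eq, Prod.smul_mk, Prod.mk_add_mk, smul_eq_mul, map_sub, map_add, map_smul] at this ⊢
    convert this using 2
    linear_combination (a + b + χ o) * (-hαβ)
  have hdisj : Disjoint s t := by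
    rw [Set.disjoint_left]
    rintro ⟨x, r⟩ ⟨c, hc, hx⟩ ht
    have := h x c _ hx ht
    simp only at hc this
    linarith
  obtain ⟨f, u, hfs, hft⟩ := geometric_hahn_banach_open hsc hs htc hdisj
  have hdec : ∀ x r, f (x, r) = f (x, 0) + r * f (0, 1) := by
    intro x r
    have : ((x, r) : E × ℝ) = (x, 0) + r • (0, 1) := by simp
    rw [this, map_add, map_smul, smul_eq_mul]
  -- The point `(o, a)` lies in `t` and in the closure of `s`, so the hyperplane passes through it
  -- and is not vertical.
  have hmemt : ((o, a) : E × ℝ) ∈ t := by simpa [t] using hb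
  have hu := hft _ hmemt
  have hβ : f (0, 1) < 0 := by
    have h₁ := hfs (o, a + 1) ⟨a, by simp, ha⟩
    rw [hdec] at h₁ hu
    linarith
  have hle : ∀ x c, (x, c) ∈ A → f (x, c) ≤ u := by
    intro x c hx
    refine le_of_forall_pos_lt_add fun ε hε => ?_
    have h₁ := hfs (x, c + ε / (-f (0, 1))) ⟨c, by
      have : 0 < ε / (-f (0, 1)) := div_pos hε (by linarith)
      simpa using this, hx⟩
    rw [hdec] at h₁ ⊢
    have h₂ : ε / (-f (0, 1)) * f (0, 1) = -ε := by
      rw [div_neg, neg_mul, div_mul_cancel₀ _ hβ.ne]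
    linarith
  have hu' : u = f (o, a) := le_antisymm hu (hle o a ha)
  -- Normalizing by the vertical coefficient turns `f` into minus the slope of the hyperplane.
  let φ : StrongDual ℝ E := (f (0, 1))⁻¹ • f.comp (ContinuousLinearMap.inl ℝ E ℝ)
  have hφ : ∀ x, f (x, 0) = φ x * f (0, 1) := by
    intro x
    simp only [φ, smul_apply, ContinuousLinearMap.comp_apply,
      ContinuousLinearMap.inl_apply, smul_eq_mul]
    rw [mul_comm, mul_inv_cancel_left₀ hβ.ne]
  refine ⟨φ, χ - φ, by simp, fun x c hx => ?_, fun x c hx => ?_⟩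
  · have h₁ := hle x c hx
    rw [hu', hdec x, hdec o, hφ, hφ] at h₁
    rw [map_sub]
    nlinarith
  · have h₁ := hft (x, a + b - χ (x - o) - c) (by simpa [t] using hx)
    rw [hu', hdec x, hdec o, hφ, hφ] at h₁
    simp only [sub_apply, map_sub] at h₁ ⊢
    nlinarith

/-- The triangle inequality at `x` and `-x` gives `‖φ‖ ≤ 1`; taking `x = a` gives `‖a‖ ≤ φ a`. -/
theorem mem_norming_of_forall_le {a : E} (ha : a ≠ 0) {φ : StrongDual ℝ E}
    (h : ∀ x, ‖a‖ - φ x ≤ ‖a - x‖) : φ ∈ norming a := by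
  have h₁ : ‖φ‖ ≤ 1 := by
    refine φ.opNorm_le_bound zero_le_one fun x => ?_
    rw [Real.norm_eq_abs, abs_le]
    have h₁ := h x
    have h₂ := h (-x)
    have h₃ := norm_sub_le a x
    have h₄ := norm_sub_le a (-x)
    simp only [map_neg, norm_neg] at h₂ h₄
    constructor <;> linarith
  have h₂ : φ a = ‖a‖ := by
    refine le_antisymm ?_ (by simpa using h a)
    exact (le_abs_self _).trans ((φ.le_opNorm a).trans
      (mul_le_of_le_one_left (norm_nonneg a) h₁))
  refine ⟨le_antisymm h₁ ?_, h₂⟩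
  have h₃ := (le_abs_self _).trans (φ.le_opNorm a)
  rw [h₂] at h₃
  exact le_of_mul_le_mul_right (by simpa using h₃) (norm_pos_iff.mpr ha)

/-- A functional that calibrates all networks branching according to `P` lies in the value
of `P`. -/
theorem Parenthesization.mem_eval_of_forall_le {q : ι → E} {I : Finset ι}
    (P : Parenthesization I) {o : E} (hq : ∀ i ∈ I, q i ≠ o) {φ : StrongDual ℝ E}
    (h : ∀ x c, P.Joins q x c → ∑ i ∈ I, ‖q i - o‖ - φ (x - o) ≤ c) :
    φ ∈ P.eval (fun i => norming (q i - o)) := by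
  induction P generalizing φ with
  | single i =>
    refine mem_norming_of_forall_le (sub_ne_zero.mpr (hq i (by simp))) fun x => ?_
    have := h (x + o) _ (le_refl ‖q i - (x + o)‖)
    simpa [sub_sub, add_comm] using this
  | sum hIJ P Q hP hQ =>
    rename_i I J
    rw [Finset.sum_union hIJ] at h
    -- Networks whose branch point is the root itself show that φ calibrates the sum of the two
    -- subnetwork functions.
    obtain ⟨φ₁, φ₂, rfl, h₁, h₂⟩ := exists_add_eq_of_forall_le (P.convex_joins (q := q))
      (Q.convex_joins (q := q)) (fun x c y d hx hd => hx.move hd) (P.joins_star o)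
      (Q.joins_star o) (χ := φ) fun y c₁ c₂ hc₁ hc₂ =>
        h y (c₁ + c₂) ⟨y, c₁, c₂, hc₁, hc₂, by simp⟩
    refine ⟨φ₁, hP (fun i hi => hq i (Finset.mem_union_left _ hi)) h₁,
      φ₂, hQ (fun i hi => hq i (Finset.mem_union_right _ hi)) h₂, rfl, ?_⟩
    -- Test on the star at `o` with one extra edge from `o` to the root `x + o`.
    have h₃ : ∀ x, -((φ₁ + φ₂) x) ≤ ‖x‖ := by
      intro x
      have := h (x + o) _ ⟨o, _, _, P.joins_star o, Q.joins_star o, le_rfl⟩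
      simp only [add_sub_cancel_right, sub_add_cancel_right, norm_neg] at this
      linarith
    refine ContinuousLinearMap.opNorm_le_bound _ zero_le_one fun x => ?_
    rw [Real.norm_eq_abs, abs_le]
    have h₄ := h₃ x
    have h₅ := h₃ (-x)
    rw [map_neg, norm_neg] at h₅
    constructor <;> linarith

end Calibration

/-! ### Passing between branching networks and Steiner trees -/

section Networks

variable {E : Type*} [NormedAddCommGroup E] {ι : Type*} [DecidableEq ι]

/-- The distance between the two points of an unordered pair. -/
def segLength : Sym2 E → ℝ :=
  Sym2.lift ⟨fun x y : E => ‖x - y‖, fun x y => norm_sub_rev x y⟩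

theorem segLength_mk (x y : E) : segLength s(x, y) = ‖x - y‖ := rfl

theorem segLength_nonneg (e : Sym2 E) : 0 ≤ segLength e := by
  induction e with
  | _ x y => exact norm_nonneg (x - y)

theorem edgeLength_eq (V : Finset E) (e : Sym2 V) :
    edgeLength V e = segLength (e.map Subtype.val) := by
  induction e with
  | _ x y => rfl

open Classical in
/-- A network branching according to `P` is realised by a finite set of segments. -/
theorem Parenthesization.Joins.exists_edges {q : ι → E} {I : Finset ι} {P : Parenthesization I}
    {x : E} {c : ℝ} (h : P.Joins q x c) :
    ∃ F : Finset (Sym2 E), ∑ e ∈ F, segLength e ≤ c ∧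
      ∀ i ∈ I, (SimpleGraph.fromEdgeSet (F : Set (Sym2 E))).Reachable (q i) x := by
  have hadj : ∀ {F : Finset (Sym2 E)} {u v : E}, s(u, v) ∈ F →
      (SimpleGraph.fromEdgeSet (F : Set (Sym2 E))).Reachable u v := by
    intro F u v huv
    by_cases hne : u = v
    · exact hne ▸ SimpleGraph.Reachable.refl _
    · exact SimpleGraph.Adj.reachable ((SimpleGraph.fromEdgeSet_adj _).mpr ⟨huv, hne⟩)
  induction P generalizing x c with
  | single i =>
    refine ⟨{s(q i, x)}, by simpa [segLength_mk, Joins] using h, fun j hj => ?_⟩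
    rw [Finset.mem_singleton.mp hj]
    exact hadj (by simp)
  | sum hIJ P Q hP hQ =>
    obtain ⟨y, c₁, c₂, h₁, h₂, hc⟩ := h
    obtain ⟨F₁, hF₁, hr₁⟩ := hP h₁
    obtain ⟨F₂, hF₂, hr₂⟩ := hQ h₂
    -- Segments common to both subnetworks are counted once, so the union can only be shorter.
    have hsum : ∀ A B : Finset (Sym2 E), ∑ e ∈ A ∪ B, segLength e ≤
        ∑ e ∈ A, segLength e + ∑ e ∈ B, segLength e := by
      intro A B
      rw [← Finset.sum_union_inter]
      exact le_add_of_nonneg_right (Finset.sum_nonneg fun e _ => segLength_nonneg e)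
    have hs₁ := hsum {s(y, x)} (F₁ ∪ F₂)
    have hs₂ := hsum F₁ F₂
    rw [Finset.sum_singleton, segLength_mk] at hs₁
    have hyx := hadj (F := {s(y, x)} ∪ (F₁ ∪ F₂)) (u := y) (v := x) (by simp)
    refine ⟨{s(y, x)} ∪ (F₁ ∪ F₂), by linarith, fun i hi => ?_⟩
    rcases Finset.mem_union.mp hi with hi | hi
    · refine ((hr₁ i hi).mono (SimpleGraph.fromEdgeSet_mono ?_)).trans hyx
      intro e he
      simp [Finset.mem_coe.mp he]
    · refine ((hr₂ i hi).mono (SimpleGraph.fromEdgeSet_mono ?_)).trans hyx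
      intro e he
      simp [Finset.mem_coe.mp he]

open Classical in
/-- A finite set of segments that connects `N` contains a Steiner tree of `N`. -/
theorem exists_isSteinerTree_length_le {N : Finset E} {F : Finset (Sym2 E)} {x : E}
    (h : ∀ v ∈ N, (SimpleGraph.fromEdgeSet (F : Set (Sym2 E))).Reachable v x) :
    ∃ T : PointGraph E, IsSteinerTree N T ∧ T.length ≤ ∑ e ∈ F, segLength e := by
  set G := SimpleGraph.fromEdgeSet (F : Set (Sym2 E)) with hG
  -- The component of `x` contains `N` and is finite, as its vertices other than `x` are endpoints
  -- of segments in `F`; a spanning tree of it is the Steiner tree.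
  let C := G.connectedComponentMk x
  have hfin : C.supp.Finite := by
    refine (insert x (F.biUnion Sym2.toFinset)).finite_toSet.subset fun v hv => ?_
    obtain ⟨w⟩ := SimpleGraph.ConnectedComponent.exact hv
    cases w with
    | nil => simp
    | cons hadj w =>
      rw [hG, SimpleGraph.fromEdgeSet_adj] at hadj
      simp only [Finset.coe_insert, Set.mem_insert_iff, Finset.mem_coe, Finset.mem_biUnion,
        Sym2.mem_toFinset]
      exact Or.inr ⟨_, hadj.1, Sym2.mem_mk_left _ _⟩
  have hcon : ∀ s : Set E, s = C.supp → (G.induce s).Connected := by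
    rintro s rfl
    exact C.connected_toSimpleGraph
  have hH : (G.comap (Subtype.val : hfin.toFinset → E)).Connected :=
    hcon (hfin.toFinset : Set E) hfin.coe_toFinset
  obtain ⟨T, hT, htree⟩ := hH.exists_isTree_le
  refine ⟨⟨hfin.toFinset, T⟩, ⟨fun v hv => ?_, htree⟩, ?_⟩
  · rw [Set.Finite.mem_toFinset]
    exact SimpleGraph.ConnectedComponent.sound (h v hv)
  · rw [PointGraph.length]
    simp only [edgeLength_eq]
    rw [← Finset.sum_image (f := segLength) (g := Sym2.map Subtype.val)
      fun a _ b _ hab => Sym2.map.injective Subtype.val_injective hab]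
    refine Finset.sum_le_sum_of_subset_of_nonneg ?_ fun e _ _ => segLength_nonneg e
    intro e he
    obtain ⟨e, he', rfl⟩ := Finset.mem_image.mp he
    clear he
    rw [SimpleGraph.mem_edgeFinset] at he'
    induction e with
    | _ u v =>
      have := hT (SimpleGraph.mem_edgeSet _ |>.mp he')
      exact ((SimpleGraph.fromEdgeSet_adj _).mp (SimpleGraph.comap_adj.mp this)).1

/-- The terminals with indices in the possibly empty set `I` can be joined to `x` by a network
of length at most `c`. -/
def Joinable (q : ι → E) (I : Finset ι) (x : E) (c : ℝ) : Prop :=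
  0 ≤ c ∧ (I.Nonempty → ∃ P : Parenthesization I, P.Joins q x c)

namespace Joinable

variable {q : ι → E} {I J : Finset ι} {x y : E} {c d : ℝ}

theorem move (h : Joinable q I x c) (hd : ‖x - y‖ + c ≤ d) : Joinable q I y d := by
  refine ⟨by linarith [h.1, norm_nonneg (x - y)], fun hI => ?_⟩
  obtain ⟨P, hP⟩ := h.2 hI
  exact ⟨P, hP.move hd⟩

theorem mono (h : Joinable q I x c) (hd : c ≤ d) : Joinable q I x d :=
  h.move (by simpa using hd)

theorem union (h₁ : Joinable q I x c) (h₂ : Joinable q J x d) (hIJ : Disjoint I J) :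
    Joinable q (I ∪ J) x (c + d) := by
  rcases I.eq_empty_or_nonempty with rfl | hI
  · rw [Finset.empty_union]
    exact h₂.mono (by linarith [h₁.1])
  rcases J.eq_empty_or_nonempty with rfl | hJ
  · rw [Finset.union_empty]
    exact h₁.mono (by linarith [h₂.1])
  obtain ⟨P, hP⟩ := h₁.2 hI
  obtain ⟨Q, hQ⟩ := h₂.2 hJ
  exact ⟨add_nonneg h₁.1 h₂.1, fun _ => ⟨.sum hIJ P Q, x, c, d, hP, hQ, by simp⟩⟩

theorem of_forall_eq (h : ∀ i ∈ I, q i = x) : Joinable q I x 0 := by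
  induction I using Finset.induction_on with
  | empty => exact ⟨le_rfl, fun h => absurd h (by simp)⟩
  | insert i I hi ih =>
    have h₁ : Joinable q {i} x 0 :=
      ⟨le_rfl, fun _ => ⟨.single i, by simp [Parenthesization.Joins, h i (by simp)]⟩⟩
    have := h₁.union (ih fun j hj => h j (Finset.mem_insert_of_mem hj)) (by simpa using hi)
    rwa [← Finset.insert_eq, add_zero] at this

/-- Networks at the vertices of a tree, given by its parent map, can be collected at the root. -/
theorem biUnion {α : Type*} [DecidableEq α] {pt : α → E} {par : α → α} (d : α → ℕ) {r : α}
    (S : Finset α) (hr : r ∉ S) (hpar : ∀ v ∈ S, par v ∈ insert r S ∧ d (par v) < d v)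
    {L : α → Finset ι} {c : α → ℝ}
    (hL : ∀ v ∈ insert r S, ∀ w ∈ insert r S, v ≠ w → Disjoint (L v) (L w))
    (h : ∀ v ∈ insert r S, Joinable q (L v) (pt v) (c v)) :
    Joinable q ((insert r S).biUnion L) (pt r)
      (∑ v ∈ insert r S, c v + ∑ v ∈ S, ‖pt v - pt (par v)‖) := by
  -- A vertex `a` of greatest depth is no other vertex's parent, so it is a leaf: carry its
  -- terminals and cost, plus the edge, to `par a` and delete it.
  induction S using Finset.induction_on_max_value d generalizing L c with
  | empty => simpa using h
  | insert a S ha hmax ih =>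
    have hra : r ≠ a := fun h => hr (by simp [h])
    have hpa : par a ∈ insert r S := by
      have h₁ := hpar a (by simp)
      have h₂ : par a ≠ a := fun h => by rw [h] at h₁; exact h₁.2.ne rfl
      simpa [h₂] using h₁.1
    have hpa' : par a ∈ insert r (insert a S) := by
      rw [Finset.insert_comm]; exact Finset.mem_insert_of_mem hpa
    have haS : a ∉ insert r S := by simp [ha, hra.symm]
    have hne : par a ≠ a := fun h => haS (h ▸ hpa)
    have hdisj := hL (par a) hpa' a (by simp) hne
    have key := @ih (fun h => hr (Finset.mem_insert_of_mem h)) (fun v hv => by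
        have h₁ := hpar v (Finset.mem_insert_of_mem hv)
        have h₂ : par v ≠ a := by
          intro h
          rw [h] at h₁
          exact absurd (hmax v hv) (not_le.mpr h₁.2)
        refine ⟨by simpa [h₂] using h₁.1, h₁.2⟩)
      (Function.update L (par a) (L (par a) ∪ L a))
      (Function.update c (par a) (c (par a) + (‖pt a - pt (par a)‖ + c a)))
      (fun v hv w hw hvw => by
        have hv' : v ∈ insert r (insert a S) := by
          rw [Finset.insert_comm]; exact Finset.mem_insert_of_mem hv
        have hw' : w ∈ insert r (insert a S) := by
          rw [Finset.insert_comm]; exact Finset.mem_insert_of_mem hw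
        have hva : v ≠ a := fun h => haS (h ▸ hv)
        have hwa : w ≠ a := fun h => haS (h ▸ hw)
        have h₁ := hL v hv' w hw' hvw
        have h₂ := hL v hv' a (by simp) hva
        have h₃ := hL a (by simp) w hw' hwa.symm
        by_cases hv₁ : v = par a
        · subst hv₁
          rw [Function.update_self, Function.update_of_ne hvw.symm]
          exact Finset.disjoint_union_left.mpr ⟨h₁, h₃⟩
        · rw [Function.update_of_ne hv₁]
          by_cases hw₁ : w = par a
          · subst hw₁
            rw [Function.update_self]
            exact Finset.disjoint_union_right.mpr ⟨h₁, h₂⟩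
          · rwa [Function.update_of_ne hw₁])
      (fun v hv => by
        by_cases hv₁ : v = par a
        · subst hv₁
          rw [Function.update_self, Function.update_self]
          exact (h _ hpa').union ((h a (by simp)).move le_rfl) hdisj
        · rw [Function.update_of_ne hv₁, Function.update_of_ne hv₁]
          exact h v (by rw [Finset.insert_comm]; exact Finset.mem_insert_of_mem hv))
    convert key using 1
    · ext i
      simp only [Finset.mem_biUnion]
      constructor
      · rintro ⟨v, hv, hi⟩
        by_cases hva : v = a
        · exact ⟨par a, hpa, by simp [← hva, hi]⟩
        · refine ⟨v, by rw [Finset.insert_comm] at hv; exact Finset.mem_of_mem_insert_of_ne hv hva, ?_⟩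
          by_cases hv₁ : v = par a
          · simp [← hv₁, hi]
          · rwa [Function.update_of_ne hv₁]
      · rintro ⟨v, hv, hi⟩
        have hv' : v ∈ insert r (insert a S) := by
          rw [Finset.insert_comm]; exact Finset.mem_insert_of_mem hv
        by_cases hv₁ : v = par a
        · subst hv₁
          rw [Function.update_self, Finset.mem_union] at hi
          rcases hi with hi | hi
          · exact ⟨_, hv', hi⟩
          · exact ⟨a, by simp, hi⟩
        · exact ⟨v, hv', by rwa [Function.update_of_ne hv₁] at hi⟩
    · rw [Finset.sum_update_of_mem hpa, Finset.insert_comm, Finset.sum_insert haS,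
        Finset.sum_insert ha, ← Finset.add_sum_erase _ c hpa, Finset.sdiff_singleton_eq_erase]
      ring

end Joinable

theorem exists_adj_dist_lt {V : Type*} {G : SimpleGraph V} (hG : G.Connected) {r v : V}
    (hv : v ≠ r) : ∃ w, G.Adj v w ∧ G.dist w r < G.dist v r := by
  obtain ⟨p, hp⟩ := hG.exists_walk_length_eq_dist v r
  cases p with
  | nil => exact absurd rfl hv
  | cons hadj p =>
    refine ⟨_, hadj, ?_⟩
    rw [← hp, SimpleGraph.Walk.length_cons]
    exact Nat.lt_succ_of_le (SimpleGraph.dist_le p)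

open Classical in
/-- A connected graph joins its vertices to any of them. -/
theorem joinable_of_connected {T : PointGraph E} (hT : T.graph.Connected) {q : ι → E}
    {I : Finset ι} (hq : ∀ i ∈ I, q i ∈ T.verts) {x : E} (hx : x ∈ T.verts) :
    Joinable q I x T.length := by
  let r : T.verts := ⟨x, hx⟩
  have hex : ∀ v, ∃ w, v ≠ r → T.graph.Adj v w ∧ T.graph.dist w r < T.graph.dist v r := by
    intro v
    by_cases hv : v = r
    · exact ⟨r, fun h => absurd hv h⟩
    · obtain ⟨w, hw⟩ := exists_adj_dist_lt hT hv
      exact ⟨w, fun _ => hw⟩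
  choose par hpar using hex
  have key := Joinable.biUnion (q := q) (pt := (Subtype.val : T.verts → E)) (par := par) (r := r)
    (fun v => T.graph.dist v r) (Finset.univ.erase r) (by simp)
    (fun v hv => ⟨by simp, (hpar v (Finset.ne_of_mem_erase hv)).2⟩)
    (L := fun v => I.filter fun i => q i = v) (c := fun _ => 0)
    (fun v _ w _ hvw => Finset.disjoint_filter.mpr fun i _ hi hi' =>
      hvw (Subtype.ext (hi.symm.trans hi')))
    (fun v _ => Joinable.of_forall_eq fun i hi => (Finset.mem_filter.mp hi).2)
  rw [Finset.insert_erase (Finset.mem_univ r), Finset.sum_const_zero, zero_add] at key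
  have hI : (Finset.univ.biUnion fun v : T.verts => I.filter fun i => q i = v) = I := by
    ext i
    simp only [Finset.mem_biUnion, Finset.mem_univ, true_and, Finset.mem_filter]
    exact ⟨fun ⟨_, hi, _⟩ => hi, fun hi => ⟨⟨q i, hq i hi⟩, hi, rfl⟩⟩
  rw [hI] at key
  refine key.mono ?_
  rw [PointGraph.length]
  -- Parent edges are distinct: two vertices cannot be each other's parent, since the distance to
  -- `r` strictly drops.
  have hinj : Set.InjOn (fun v => s(v, par v)) (Finset.univ.erase r : Finset T.verts) := by
    intro v hv w hw hvw
    rcases Sym2.eq_iff.mp hvw with h | ⟨h₁, h₂⟩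
    · exact h.1
    · have h₃ := (hpar v (by simpa using hv)).2
      have h₄ := (hpar w (by simpa using hw)).2
      rw [h₂] at h₃
      rw [← h₁] at h₄
      exact absurd h₃ h₄.asymm
  calc ∑ v ∈ Finset.univ.erase r, ‖(v : E) - par v‖
      = ∑ e ∈ (Finset.univ.erase r).image fun v => s(v, par v), edgeLength T.verts e := by
        rw [Finset.sum_image hinj]
        rfl
    _ ≤ _ := by
        refine Finset.sum_le_sum_of_subset_of_nonneg (fun e he => ?_) fun e _ _ => ?_
        · obtain ⟨v, hv, rfl⟩ := Finset.mem_image.mp he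
          rw [SimpleGraph.mem_edgeFinset]
          exact (hpar v (Finset.ne_of_mem_erase hv)).1
        · rw [edgeLength_eq]
          exact segLength_nonneg _

open Classical in
theorem isSteinerTree_starAt {E : Type*} {c : E} {N : Finset E} : IsSteinerTree N (starAt c N) :=
  ⟨Finset.subset_insert c N, SimpleGraph.isTree_starGraph _⟩

open Classical in
theorem length_starAt {c : E} {N : Finset E} (hc : c ∉ N) :
    (starAt c N).length = ∑ v ∈ N, ‖v - c‖ := by
  let r : (starAt c N).verts := ⟨c, Finset.mem_insert_self c N⟩
  have hmem : ∀ v : N, (v : E) ∈ (starAt c N).verts := fun v => Finset.mem_insert_of_mem v.2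
  have hne : ∀ v : N, (v : E) ≠ c := fun v h => hc (h ▸ v.2)
  have hedge : (starAt c N).graph.edgeFinset =
      N.attach.image fun v : N => s((⟨v, hmem v⟩ : (starAt c N).verts), r) := by
    ext e
    rw [SimpleGraph.mem_edgeFinset, Finset.mem_image]
    induction e with
    | _ u v =>
      rw [SimpleGraph.mem_edgeSet]
      change (SimpleGraph.starGraph r).Adj u v ↔ _
      rw [SimpleGraph.starGraph_adj]
      have hN : ∀ w : (starAt c N).verts, w ≠ r → (w : E) ∈ N := fun w hw =>
        Finset.mem_of_mem_insert_of_ne w.2 fun h => hw (Subtype.ext h)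
      constructor
      · rintro ⟨huv, rfl | rfl⟩
        · exact ⟨⟨v, hN v huv.symm⟩, Finset.mem_attach _ _, Sym2.eq_swap⟩
        · exact ⟨⟨u, hN u huv⟩, Finset.mem_attach _ _, rfl⟩
      · rintro ⟨w, -, hw⟩
        have hwr : (⟨w, hmem w⟩ : (starAt c N).verts) ≠ r := fun h =>
          hne w (congrArg Subtype.val h)
        rcases Sym2.eq_iff.mp hw with ⟨rfl, rfl⟩ | ⟨rfl, rfl⟩
        · exact ⟨hwr, Or.inr rfl⟩
        · exact ⟨hwr.symm, Or.inl rfl⟩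
  rw [PointGraph.length, hedge, Finset.sum_image, ← Finset.sum_attach N]
  · rfl
  · intro v _ w _ hvw
    rcases Sym2.eq_iff.mp hvw with h | h
    · exact Subtype.ext (congrArg (fun u : (starAt c N).verts => (u : E)) h.1)
    · exact absurd (congrArg Subtype.val h.1) (hne v)

end Networks

/-! ### Optimality of stars, and the differentiable case -/

section Stars

variable {E : Type*} [NormedAddCommGroup E] {ι : Type*}

theorem length_starAt_image [DecidableEq E] {q : ι → E} {I : Finset ι} {o : E}
    (hq : Set.InjOn q I) (ho : ∀ i ∈ I, q i ≠ o) :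
    (starAt o (I.image q)).length = ∑ i ∈ I, ‖q i - o‖ := by
  rw [length_starAt, Finset.sum_image hq]
  intro h
  obtain ⟨i, hi, h⟩ := Finset.mem_image.mp h
  exact ho i hi h

variable [NormedSpace ℝ E] [DecidableEq ι]

theorem zero_mem_eval_of_isSMT [DecidableEq E] {q : ι → E} {I : Finset ι} {o : E}
    (hq : Set.InjOn q I) (ho : ∀ i ∈ I, q i ≠ o)
    (h : IsSMT (I.image q) (starAt o (I.image q))) (P : Parenthesization I) :
    0 ∈ P.eval (fun i => norming (q i - o)) := by
  refine P.mem_eval_of_forall_le ho fun x c hc => ?_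
  obtain ⟨F, hF, hr⟩ := hc.exists_edges
  obtain ⟨T, hT, hlen⟩ := exists_isSteinerTree_length_le (N := I.image q) (F := F) (x := x)
    fun v hv => by
      obtain ⟨i, hi, rfl⟩ := Finset.mem_image.mp hv
      exact hr i hi
  have := h.2 T hT
  rw [length_starAt_image hq ho] at this
  simp only [zero_apply, sub_zero]
  linarith

/-- Apply the hypothesis to the bracketing that adds `m` last; the norm bound on the final sum is
void for `0`. -/
theorem zero_mem_eval_add {A : ι → Set (StrongDual ℝ E)} {I J : Finset ι} {m : ι}
    (hm : m ∉ I) (hJ : J = I ∪ {m}) (h : ∀ P : Parenthesization J, 0 ∈ P.eval A)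
    (P : Parenthesization I) : 0 ∈ P.eval A + A m := by
  subst hJ
  obtain ⟨φ, hφ, ψ, hψ, h0, -⟩ := h (.sum (by simpa using hm) P (.single m))
  exact Set.mem_add.mpr ⟨φ, hφ, ψ, hψ, h0.symm⟩

theorem isSMT_of_zero_mem_eval_add [DecidableEq E] {q : ι → E} {I J : Finset ι} {o : E} {m : ι}
    (hq : Set.InjOn q J) (ho : ∀ i ∈ J, q i ≠ o) (hI : I.Nonempty) (hm : m ∉ I)
    (hJ : J = I ∪ {m})
    (h : ∀ P : Parenthesization I,
      0 ∈ P.eval (fun i => norming (q i - o)) + norming (q m - o)) :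
    IsSMT (J.image q) (starAt o (J.image q)) := by
  refine ⟨isSteinerTree_starAt, fun T hT => ?_⟩
  have hmem : ∀ i ∈ J, q i ∈ T.verts := fun i hi => hT.1 (Finset.mem_image_of_mem q hi)
  -- The competing tree is rooted at the terminal `q m`. Since φ = -ψ, the calibration term -φ(q m -
  -- o) equals the missing edge length `‖q m - o‖`.
  obtain ⟨P, hP⟩ := (joinable_of_connected hT.2.connected (q := q) (I := I)
    (fun i hi => hmem i (by simp [hJ, hi])) (hmem m (by simp [hJ]))).2 hI
  obtain ⟨φ, hφ, ψ, hψ, h0⟩ := Set.mem_add.mp (h P)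
  have h₁ := hP.le_of_mem_eval hφ
  rw [length_starAt_image hq ho, hJ, Finset.sum_union (by simpa using hm), Finset.sum_singleton,
    ← hψ.2]
  rw [eq_neg_of_add_eq_zero_left h0, neg_apply] at h₁
  linarith

theorem zero_notMem_eval_of_eq_singleton {A : ι → Set (StrongDual ℝ E)} {J : Finset ι} {m : ι}
    (hJ : J = {m}) (h0 : 0 ∉ A m) : ¬ ∀ P : Parenthesization J, 0 ∈ P.eval A := by
  subst hJ
  exact fun h => h0 (h (.single m))

theorem zero_notMem_norming (x : E) : 0 ∉ norming x := fun h => by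
  have := h.1
  simp at this

/-- Existence is Hahn-Banach. For uniqueness, y ↦ ‖y‖ - ψ(y) is minimal at `x` for any norming ψ, so
its derivative vanishes there. -/
theorem norming_eq_singleton {x : E} (hx : x ≠ 0)
    (h : DifferentiableAt ℝ (fun y : E => ‖y‖) x) :
    norming x = {fderiv ℝ (fun y : E => ‖y‖) x} := by
  refine Set.eq_singleton_iff_nonempty_unique_mem.mpr ⟨?_, fun ψ hψ => ?_⟩
  · obtain ⟨g, hg, hgx⟩ := exists_dual_vector ℝ x (norm_ne_zero_iff.mpr hx)
    exact ⟨g, hg, by simpa using hgx⟩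
  · have hmin : IsLocalMin (fun y : E => ‖y‖ - ψ y) x := by
      refine Filter.Eventually.of_forall fun y => ?_
      have := (le_abs_self _).trans (ψ.le_opNorm y)
      rw [hψ.1, one_mul] at this
      simpa [hψ.2] using this
    have hd := hmin.hasFDerivAt_eq_zero (h.hasFDerivAt.sub ψ.hasFDerivAt)
    exact (sub_eq_zero.mp hd).symm

theorem exists_parenthesization {I : Finset ι} (hI : I.Nonempty) :
    Nonempty (Parenthesization I) := by
  induction hI using Finset.Nonempty.cons_induction with
  | singleton i => exact ⟨.single i⟩
  | cons i I hi hI ih =>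
    obtain ⟨P⟩ := ih
    rw [Finset.cons_eq_insert, Finset.insert_eq]
    exact ⟨.sum (by simpa using hi) (.single i) P⟩

theorem Parenthesization.eq_sum_of_mem_eval {φ : ι → StrongDual ℝ E}
    {A : ι → Set (StrongDual ℝ E)} {I : Finset ι} (P : Parenthesization I)
    (hA : ∀ i ∈ I, A i = {φ i}) (hφ : ∀ i ∈ I, ‖φ i‖ ≤ 1) {χ : StrongDual ℝ E}
    (h : χ ∈ P.eval A) : χ = ∑ i ∈ I, φ i ∧ ‖χ‖ ≤ 1 := by
  induction P generalizing χ with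
  | single i =>
    simp only [eval] at h
    rw [hA i (by simp), Set.mem_singleton_iff] at h
    subst h
    exact ⟨by simp, hφ i (by simp)⟩
  | sum hIJ P Q hP hQ =>
    obtain ⟨φ₁, h₁, φ₂, h₂, rfl, hn⟩ := h
    refine ⟨?_, hn⟩
    rw [Finset.sum_union hIJ,
      (hP (fun i hi => hA i (Finset.mem_union_left _ hi))
        (fun i hi => hφ i (Finset.mem_union_left _ hi)) h₁).1,
      (hQ (fun i hi => hA i (Finset.mem_union_right _ hi))
        (fun i hi => hφ i (Finset.mem_union_right _ hi)) h₂).1]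

theorem Parenthesization.sum_mem_eval {φ : ι → StrongDual ℝ E}
    {A : ι → Set (StrongDual ℝ E)} {I : Finset ι} (P : Parenthesization I)
    (hA : ∀ i ∈ I, φ i ∈ A i) (hφ : ∀ J ⊆ I, ‖∑ i ∈ J, φ i‖ ≤ 1) :
    ∑ i ∈ I, φ i ∈ P.eval A := by
  induction P with
  | single i => simpa [eval] using hA i (by simp)
  | sum hIJ P Q hP hQ =>
    exact ⟨_, hP (fun i hi => hA i (Finset.mem_union_left _ hi))
        (fun J hJ => hφ J (hJ.trans Finset.subset_union_left)),
      _, hQ (fun i hi => hA i (Finset.mem_union_right _ hi))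
        (fun J hJ => hφ J (hJ.trans Finset.subset_union_right)),
      Finset.sum_union hIJ, hφ _ subset_rfl⟩

/-- For singletons, all parenthesizations contain `0` if and only if the elements sum to `0` and
all subset sums lie in the dual unit ball. -/
theorem forall_zero_mem_eval_iff {φ : ι → StrongDual ℝ E} {A : ι → Set (StrongDual ℝ E)}
    {I : Finset ι} (hI : I.Nonempty) (hA : ∀ i ∈ I, A i = {φ i}) (hφ : ∀ i ∈ I, ‖φ i‖ ≤ 1) :
    (∀ P : Parenthesization I, 0 ∈ P.eval A) ↔
      ∑ i ∈ I, φ i = 0 ∧ ∀ J ⊆ I, ‖∑ i ∈ J, φ i‖ ≤ 1 := by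
  constructor
  · intro h
    obtain ⟨P⟩ := exists_parenthesization hI
    have h0 := (P.eq_sum_of_mem_eval hA hφ (h P)).1.symm
    refine ⟨h0, fun J hJ => ?_⟩
    rcases J.eq_empty_or_nonempty with rfl | hJ₀
    · simp
    rcases (I \ J).eq_empty_or_nonempty with hK | hK
    · rw [hJ.antisymm (Finset.sdiff_eq_empty_iff_subset.mp hK), h0]
      simp
    obtain ⟨Q⟩ := exists_parenthesization hJ₀
    obtain ⟨R⟩ := exists_parenthesization hK
    have hIJ : J ∪ I \ J = I := Finset.union_sdiff_of_subset hJ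
    -- The index set is part of the type, so the bracketing of `J ∪ I \ J` must be transported to
    -- `I`. Its first factor forces the sum over `J` into the dual ball.
    have key : ∀ K, K = I → ∀ P : Parenthesization K, 0 ∈ P.eval A := by
      rintro _ rfl
      exact h
    obtain ⟨χ, hχ, -⟩ := key _ hIJ (.sum Finset.disjoint_sdiff Q R)
    obtain ⟨h₁, h₂⟩ := Q.eq_sum_of_mem_eval (fun i hi => hA i (hJ hi)) (fun i hi => hφ i (hJ hi)) hχ
    exact h₁ ▸ h₂
  · rintro ⟨h0, h⟩ P
    rw [← h0]
    exact P.sum_mem_eval (fun i hi => by simp [hA i hi]) h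

end Stars

end LocalSteiner

open LocalSteiner in
theorem mainTheorem5 {E : Type*} [NormedAddCommGroup E] [NormedSpace ℝ E] [FiniteDimensional ℝ E]
    [DecidableEq E]
    (k : ℕ) (hk : 1 ≤ k) (p : ℕ → E) (hp : Set.InjOn p (Set.Icc 0 k)) :
    (IsSMT ((Finset.Icc 1 k).image p) (starAt (p 0) ((Finset.Icc 1 k).image p)) ↔
      ∀ P : Parenthesization (Finset.Icc 1 k), 0 ∈ P.eval (fun i => norming (p i - p 0))) ∧
    (2 ≤ k →
      (IsSMT ((Finset.Icc 1 k).image p) (starAt (p 0) ((Finset.Icc 1 k).image p)) ↔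
        ∀ P : Parenthesization (Finset.Icc 1 (k - 1)),
          0 ∈ P.eval (fun i => norming (p i - p 0)) + norming (p k - p 0))) ∧
    ((∀ x : E, x ≠ 0 → DifferentiableAt ℝ (fun y : E => ‖y‖) x) →
      ∃ φ : ℕ → StrongDual ℝ E, (∀ i ∈ Finset.Icc 1 k, norming (p i - p 0) = {φ i}) ∧
        (IsSMT ((Finset.Icc 1 k).image p) (starAt (p 0) ((Finset.Icc 1 k).image p)) ↔
          ∑ i ∈ Finset.Icc 1 k, φ i = 0 ∧ ∀ I ⊆ Finset.Icc 1 k, ‖∑ i ∈ I, φ i‖ ≤ 1)) := by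
  have hq : Set.InjOn p (Finset.Icc 1 k : Finset ℕ) := hp.mono fun i hi => by
    simp only [Finset.coe_Icc, Set.mem_Icc] at hi ⊢
    omega
  have ho : ∀ i ∈ Finset.Icc 1 k, p i ≠ p 0 := fun i hi h => by
    rw [Finset.mem_Icc] at hi
    have := hp ⟨Nat.zero_le i, hi.2⟩ ⟨le_rfl, Nat.zero_le k⟩ h
    omega
  have hm : k ∉ Finset.Icc 1 (k - 1) := by
    rw [Finset.mem_Icc]
    omega
  have hJ : Finset.Icc 1 k = Finset.Icc 1 (k - 1) ∪ {k} := by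
    ext i
    simp only [Finset.mem_union, Finset.mem_Icc, Finset.mem_singleton]
    omega
  have h₁ := zero_mem_eval_of_isSMT hq ho
  have h₂ := zero_mem_eval_add (A := fun i => norming (p i - p 0)) hm hJ
  have h₃ : 2 ≤ k → _ := fun h2 =>
    isSMT_of_zero_mem_eval_add hq ho (Finset.nonempty_Icc.mpr (by omega)) hm hJ
  have h₄ : IsSMT ((Finset.Icc 1 k).image p) (starAt (p 0) ((Finset.Icc 1 k).image p)) ↔
      ∀ P : Parenthesization (Finset.Icc 1 k), 0 ∈ P.eval (fun i => norming (p i - p 0)) := by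
    refine ⟨h₁, fun h => ?_⟩
    -- For `k = 1` nothing remains to be bracketed after removing the last terminal, but the
    -- condition fails, as `0` is never norming.
    rcases hk.eq_or_lt with rfl | h2
    · exact absurd h (zero_notMem_eval_of_eq_singleton (Finset.Icc_self 1)
        (zero_notMem_norming _))
    · exact h₃ h2 (h₂ h)
  refine ⟨h₄, fun h2 => ⟨fun h => h₂ (h₁ h), h₃ h2⟩, fun hdiff => ?_⟩
  have hA : ∀ i ∈ Finset.Icc 1 k,
      norming (p i - p 0) = {fderiv ℝ (fun y : E => ‖y‖) (p i - p 0)} := fun i hi =>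
    norming_eq_singleton (sub_ne_zero.mpr (ho i hi)) (hdiff _ (sub_ne_zero.mpr (ho i hi)))
  refine ⟨_, hA, h₄.trans (forall_zero_mem_eval_iff (Finset.nonempty_Icc.mpr hk) hA ?_)⟩
  intro i hi
  have : fderiv ℝ (fun y : E => ‖y‖) (p i - p 0) ∈ norming (p i - p 0) := by
    rw [hA i hi]
    rfl
  exact this.1.le
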